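/- A class of groups $\mathcal{C}$ (closed under isomorphism) is called a root class if it contains a non-trivial group and is closed under taking subgroups, extensions, and Cartesian products $\prod_{y\in H}G_y$, where $G,H\in\mathcal{C}$ and each $G_y$ is an isomorphic copy of $G$. Let $\mathcal{C}$ be a root class consisting only of periodic groups, let $\mathfrak{P}(\mathcal{C})$ be the set of primes dividing the order of an element of some $\mathcal{C}$-group, and let $\mathfrak{P}(\mathcal{C})'$ be the set of all other primes. A $\mathfrak{P}(\mathcal{C})'$-number is a positive integer all of whose prime divisors lie in $\mathfrak{P}(\mathcal{C})'$. For a class of groups $\mathcal{D}$, a subgroup $Y$ of a group $X$ is $\mathcal{D}$-separable in $X$ if for every $x\in X\setminus Y$ there is a homomorphism $\tau$ of $X$ onto a $\mathcal{D}$-group with $\tau(x)\notin\tau(Y)$; $X$ is residually a $\mathcal{D}$-group if its trivial subgroup is $\mathcal{D}$-separable. The subgroup $Y$ is $\mathfrak{P}(\mathcal{C})'$-isolated in $X$ if $x\in X$, $q\in\mathfrak{P}(\mathcal{C})'$ and $x^q\in Y$ imply $x\in Y$; $X$ has no $\mathfrak{P}(\mathcal{C})'$-torsion if its trivial subgroup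 is $\mathfrak{P}(\mathcal{C})'$-isolated. The $\mathfrak{P}(\mathcal{C})'$-isolator $\mathfrak{Is}(X,Y)$ is the smallest $\mathfrak{P}(\mathcal{C})'$-isolated subgroup of $X$ containing $Y$, and $\mathfrak{Rt}(X,Y)$ is the set of all $x\in X$ such that $x^q\in Y$ for some $\mathfrak{P}(\mathcal{C})'$-number $q$. An abelian group $A$ is $\mathcal{C}$-bounded if, for every quotient group $B$ of $A$ and every $p\in\mathfrak{P}(\mathcal{C})$, the $p$-power torsion subgroup of $B$ has finite exponent and cardinality not exceeding the cardinality of some $\mathcal{C}$-group. A nilpotent group is $\mathcal{C}$-bounded if it has a finite central series with $\mathcal{C}$-bounded abelian factors. Let $\mathcal{B}$ be the class of all $\mathcal{C}$-bounded nilpotent groups without $\mathfrak{P}(\mathcal{C})'$-torsion, and let $\mathcal{NC}$ be the class of all nilpotent $\mathcal{C}$-groups. Theorem 2.4. Suppose that $X$ is residually a $\mathcal{B}$-group, $Y$ is a subgroup of $X$, and $\sigma$ is a homomorphism of $X$ onto a $\mathcal{B}$-group that is injective on $Y$. Then the following statements hold. 1. The isolator $\mathfrak{Is}(X,Y)$ is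 $\mathcal{NC}$-separable in $X$, coincides with the set $\mathfrak{Rt}(X,Y)$, and is nilpotent of the same nilpotency class as the (nilpotent) group $Y$. The group $X$ is residually an $\mathcal{NC}$-group and has no $\mathfrak{P}(\mathcal{C})'$-torsion. 2. The homomorphism $\sigma$ is injective on $\mathfrak{Is}(X,Y)$, and $\mathfrak{Is}(X,Y)$ belongs to $\mathcal{B}$. -/

import Mathlib

universe u

/-- A class of groups, given by its membership predicate. -/
abbrev GroupClass : Type (u + 1) := ∀ (G : Type u) [Group G], Prop

namespace GroupClass

/-- Root classes of groups: classes (closed under isomorphism, as every class of groups is) that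
contain a non-trivial group and are closed under subgroups, extensions, and Cartesian products
`∏_{y ∈ H} G_y` of copies of `G`, where both `G` and the index set `H` are groups of the class. -/
structure IsRoot (C : GroupClass.{u}) : Prop where
  of_mulEquiv : ∀ (G H : Type u) [Group G] [Group H], C G → Nonempty (G ≃* H) → C H
  exists_nontrivial : ∃ (G : Type u) (_ : Group G), C G ∧ Nontrivial G
  subgroup : ∀ (G : Type u) [Group G] (H : Subgroup G), C G → C H
  extension : ∀ (G : Type u) [Group G] (N : Subgroup G) [N.Normal], C N → C (G ⧸ N) → C G
  cartesianPower : ∀ (G H : Type u) [Group G] [Group H], C G → C H → C (H → G)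

/-- The class consists of periodic groups. -/
def IsPeriodic (C : GroupClass.{u}) : Prop :=
  ∀ (G : Type u) [Group G], C G → IsMulTorsion G

/-- `𝔓(C)`: the primes that divide the order of an element of some group of the class. -/
def primes (C : GroupClass.{u}) : Set ℕ :=
  {p | p.Prime ∧ ∃ (G : Type u) (_ : Group G), C G ∧ ∃ g : G, IsOfFinOrder g ∧ p ∣ orderOf g}

/-- `𝔓(C)′`: the primes that do not belong to `𝔓(C)`. -/
def primesCompl (C : GroupClass.{u}) : Set ℕ :=
  {q | q.Prime ∧ q ∉ C.primes}

/-- The subgroup `Y` of `X` is separable in `X` by the class `C`. -/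
def IsSeparable (C : GroupClass.{u}) {X : Type u} [Group X] (Y : Subgroup X) : Prop :=
  ∀ x : X, x ∉ Y → ∃ (G : Type u) (_ : Group G) (σ : X →* G),
    C G ∧ Function.Surjective σ ∧ σ x ∉ Y.map σ

/-- `X` is residually a `C`-group. -/
def IsResidually (C : GroupClass.{u}) (X : Type u) [Group X] : Prop :=
  C.IsSeparable (⊥ : Subgroup X)

/-- The class of all nilpotent `C`-groups. -/
def nilpotentPart (C : GroupClass.{u}) : GroupClass.{u} :=
  fun G _ => Group.IsNilpotent G ∧ C G

end GroupClass

section Isolators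

variable {X : Type u} [Group X]

/-- For a set `Q` of primes: `Y` is `Q`-isolated in `X`. -/
def Subgroup.IsIsolated (Q : Set ℕ) (Y : Subgroup X) : Prop :=
  ∀ x : X, ∀ q ∈ Q, x ^ q ∈ Y → x ∈ Y

/-- The `Q`-isolator of `Y` in `X`: the smallest `Q`-isolated subgroup of `X` containing `Y`. -/
def Subgroup.isolator (Q : Set ℕ) (Y : Subgroup X) : Subgroup X :=
  sInf {Z : Subgroup X | Z.IsIsolated Q ∧ Y ≤ Z}

/-- `q` is a `Q`-number: a positive integer all of whose prime divisors belong to `Q`. -/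
def IsPrimeSetNumber (Q : Set ℕ) (q : ℕ) : Prop :=
  0 < q ∧ ∀ p : ℕ, p.Prime → p ∣ q → p ∈ Q

/-- The set of `Q`-roots extracted in `X` from the elements of `Y`. -/
def Subgroup.rootSet (Q : Set ℕ) (Y : Subgroup X) : Set X :=
  {x | ∃ q : ℕ, IsPrimeSetNumber Q q ∧ x ^ q ∈ Y}

end Isolators

/-- The group `X` has no `Q`-torsion. -/
def HasNoPrimeSetTorsion (Q : Set ℕ) (X : Type u) [Group X] : Prop :=
  (⊥ : Subgroup X).IsIsolated Q

/-- The elements of `p`-power order; in an abelian group this is the `p`-power torsion subgroup. -/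
def primePowerTorsion (p : ℕ) (B : Type u) [Group B] : Set B :=
  {b | ∃ k : ℕ, b ^ p ^ k = 1}

namespace GroupClass

/-- The class of `C`-bounded abelian groups: for every quotient group `B` of `A`, each primary
`𝔓(C)`-component of `B` has finite exponent and a cardinality not exceeding that of some
`C`-group. -/
def boundedAbelian (C : GroupClass.{u}) : GroupClass.{u} :=
  fun A _ => (∀ a b : A, a * b = b * a) ∧
    ∀ (N : Subgroup A) [N.Normal], ∀ p ∈ C.primes,
      (∃ m : ℕ, 0 < m ∧ ∀ b ∈ primePowerTorsion p (A ⧸ N), b ^ m = 1) ∧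
      ∃ (G : Type u) (_ : Group G), C G ∧
        Cardinal.mk (primePowerTorsion p (A ⧸ N)) ≤ Cardinal.mk G

/-- The class of `C`-bounded nilpotent groups: nilpotent groups having a finite central series
`1 = H 0 ≤ H 1 ≤ ⋯ ≤ H n = X` whose factors are `C`-bounded abelian groups. -/
def boundedNilpotent (C : GroupClass.{u}) : GroupClass.{u} :=
  fun X _ => Group.IsNilpotent X ∧
    ∃ (n : ℕ) (H : ℕ → Subgroup X) (_ : ∀ i, (H i).Normal),
      H 0 = ⊥ ∧ H n = ⊤ ∧
      ∀ i < n, H i ≤ H (i + 1) ∧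
        (∀ x ∈ H (i + 1), ∀ g : X, x * g * x⁻¹ * g⁻¹ ∈ H i) ∧
        C.boundedAbelian (H (i + 1) ⧸ (H i).subgroupOf (H (i + 1)))

/-- The class of `C`-bounded nilpotent groups without `𝔓(C)′`-torsion. -/
def boundedNilpotentTorsionFree (C : GroupClass.{u}) : GroupClass.{u} :=
  fun X _ => C.boundedNilpotent X ∧ HasNoPrimeSetTorsion C.primesCompl X

end GroupClass

/-! Let Q be the set of primes outside 𝔓(C). In a nilpotent group without Q-torsion the upper
central series is Q-isolated and Q-roots are unique; moreover, a nilpotent group generated by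
Q-roots of a subgroup consists of such roots and, without Q-torsion, is no more deeply nilpotent
than that subgroup. Testing lower central series in the residual quotients of X carries the class
bound to the subgroup generated by the Q-roots of Y
(`IsResidually.lowerCentralSeries_closure_rootSet_eq_bot`). That subgroup is then nilpotent, hence
equal to the root set and to the isolator I. An element of I killed by σ has a Q-power in Y, also
killed by σ, so it is trivial.

For separability, take x outside I. Either σ, or σ paired with one residual quotient, gives a
C-bounded nilpotent image in which x is not a Q-root of the image of I. A normal subgroup maximal
for keeping all Q-powers of x away from that image has a quotient of p-power exponent for some p in
𝔓(C), and such bounded groups lie in C (`boundedNilpotent.exists_normal`,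
`IsRoot.of_boundedNilpotent`). The same argument with I trivial gives residuality. -/

open scoped commutatorElement

/-! ### Commutators of powers -/

section CommutatorPowers

variable {G : Type*} [Group G]

theorem commutatorElement_pow_left {x g : G} (h : Commute ⁅x, g⁆ x) (n : ℕ) :
    ⁅x ^ n, g⁆ = ⁅x, g⁆ ^ n := by
  induction n with
  | zero => simp
  | succ n ih =>
    have h1 : ⁅x ^ (n + 1), g⁆ = x * ⁅x ^ n, g⁆ * x⁻¹ * ⁅x, g⁆ := by
      rw [pow_succ']; simp only [commutatorElement_def]; group
    rw [h1, ih, ← (h.pow_left n).eq, mul_inv_cancel_right, pow_succ]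

theorem commutatorElement_pow_right {x g : G} (h : Commute ⁅x, g⁆ g) (n : ℕ) :
    ⁅x, g ^ n⁆ = ⁅x, g⁆ ^ n := by
  rw [← commutatorElement_inv g x] at h
  rw [← commutatorElement_inv, commutatorElement_pow_left (Commute.inv_left_iff.1 h),
    ← commutatorElement_inv g x, inv_pow]

/-- Modulo `N` the commutator commutes with `x`, so the exponent can be pulled out. This is what
moves power conditions along the upper central series. -/
theorem commutatorElement_pow_mem_iff (N : Subgroup G) [N.Normal] {x g : G}
    (h : ⁅⁅x, g⁆, x⁆ ∈ N) (n : ℕ) : ⁅x ^ n, g⁆ ∈ N ↔ ⁅x, g⁆ ^ n ∈ N := by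
  have h' : Commute ⁅(x : G ⧸ N), (g : G ⧸ N)⁆ (x : G ⧸ N) := by
    rw [← commutatorElement_eq_one_iff_commute]
    exact (QuotientGroup.eq_one_iff (N := N) ⁅⁅x, g⁆, x⁆).2 h
  rw [← QuotientGroup.eq_one_iff, ← QuotientGroup.eq_one_iff (N := N) (⁅x, g⁆ ^ n)]
  exact Eq.congr_left (commutatorElement_pow_left h' n)

end CommutatorPowers

/-! ### Q-numbers and isolation -/

section PrimeSetNumbers

variable {Q : Set ℕ}

theorem IsPrimeSetNumber.one : IsPrimeSetNumber Q 1 :=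
  ⟨one_pos, fun _ hp h => absurd (Nat.dvd_one.1 h) hp.ne_one⟩

theorem IsPrimeSetNumber.mul {m n : ℕ} (hm : IsPrimeSetNumber Q m) (hn : IsPrimeSetNumber Q n) :
    IsPrimeSetNumber Q (m * n) :=
  ⟨Nat.mul_pos hm.1 hn.1, fun p hp h => (hp.dvd_mul.1 h).elim (hm.2 p hp) (hn.2 p hp)⟩

theorem IsPrimeSetNumber.of_prime {q : ℕ} (hq : q.Prime) (h : q ∈ Q) : IsPrimeSetNumber Q q :=
  ⟨hq.pos, fun _ hp hd => (Nat.prime_dvd_prime_iff_eq hp hq).1 hd ▸ h⟩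

theorem IsPrimeSetNumber.of_dvd {m n : ℕ} (hn : IsPrimeSetNumber Q n) (h : m ∣ n) :
    IsPrimeSetNumber Q m :=
  ⟨Nat.pos_of_dvd_of_pos h hn.1, fun p hp hd => hn.2 p hp (hd.trans h)⟩

theorem Subgroup.IsIsolated.mem_of_pow_mem {G : Type*} [Group G] {Y : Subgroup G}
    (hY : Y.IsIsolated Q) {q : ℕ} (hq : IsPrimeSetNumber Q q) {x : G} (hx : x ^ q ∈ Y) :
    x ∈ Y := by
  induction q using Nat.recOnMul generalizing x with
  | zero => exact absurd hq.1 (lt_irrefl 0)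
  | one => simpa using hx
  | prime p hp => exact hY x p (hq.2 p hp dvd_rfl) hx
  | mul a b iha ihb =>
    rw [pow_mul] at hx
    exact iha (hq.of_dvd (dvd_mul_right a b)) (ihb (hq.of_dvd (dvd_mul_left b a)) hx)

theorem HasNoPrimeSetTorsion.eq_one_of_pow_eq_one {G : Type*} [Group G]
    (hG : HasNoPrimeSetTorsion Q G) {q : ℕ} (hq : IsPrimeSetNumber Q q) {x : G}
    (hx : x ^ q = 1) : x = 1 :=
  Subgroup.mem_bot.1 (Subgroup.IsIsolated.mem_of_pow_mem hG hq (Subgroup.mem_bot.2 hx))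

theorem HasNoPrimeSetTorsion.of_injective {G H : Type*} [Group G] [Group H]
    (hH : HasNoPrimeSetTorsion Q H) (f : G →* H) (hf : Function.Injective f) :
    HasNoPrimeSetTorsion Q G := by
  intro x q hq hx
  have h : f x ^ q ∈ (⊥ : Subgroup H) := by
    rw [Subgroup.mem_bot] at hx ⊢
    rw [← map_pow, hx, map_one]
  have := Subgroup.mem_bot.1 (hH (f x) q hq h)
  exact Subgroup.mem_bot.2 (hf (this.trans (map_one f).symm))

end PrimeSetNumbers

/-! ### Unique roots and isolated upper central series -/

section UniqueRoots

open Subgroup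

variable {Q : Set ℕ} {G : Type*} [Group G]

/-- Commutators with `x` lie one term lower, and modulo the next term `⁅x ^ q, g⁆` is `⁅x, g⁆ ^ q`;
induction thus descends to torsion-freeness in the trivial term. -/
theorem HasNoPrimeSetTorsion.mem_upperCentralSeries_of_pow_mem_of_mem_succ
    (hG : HasNoPrimeSetTorsion Q G) {q : ℕ} (hq : IsPrimeSetNumber Q q) (i : ℕ) {x : G}
    (hx : x ∈ Subgroup.upperCentralSeries G (i + 1)) (hxq : x ^ q ∈ Subgroup.upperCentralSeries G i) :
    x ∈ Subgroup.upperCentralSeries G i := by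
  induction i generalizing x with
  | zero => exact Subgroup.mem_bot.2 (hG.eq_one_of_pow_eq_one hq (Subgroup.mem_bot.1 hxq))
  | succ i ih =>
    intro g
    exact ih (hx g) ((commutatorElement_pow_mem_iff (Subgroup.upperCentralSeries G i) (hx g x) q).1 (hxq g))

/-- The terms of the upper central series of a nilpotent group without `Q`-torsion are
`Q`-isolated. -/
theorem HasNoPrimeSetTorsion.mem_upperCentralSeries_of_pow_mem [Group.IsNilpotent G]
    (hG : HasNoPrimeSetTorsion Q G) {q : ℕ} (hq : IsPrimeSetNumber Q q) {i : ℕ} {x : G}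
    (hxq : x ^ q ∈ Subgroup.upperCentralSeries G i) : x ∈ Subgroup.upperCentralSeries G i := by
  obtain ⟨n, hn⟩ := Group.IsNilpotent.nilpotent G
  have key : ∀ k, x ∈ Subgroup.upperCentralSeries G (i + k) → x ∈ Subgroup.upperCentralSeries G i := by
    intro k
    induction k with
    | zero => exact id
    | succ k ih =>
      intro h
      exact ih (hG.mem_upperCentralSeries_of_pow_mem_of_mem_succ hq (i + k) h
        (Subgroup.upperCentralSeries_mono G (Nat.le_add_right i k) hxq))
  exact key n (Subgroup.upperCentralSeries_mono G (Nat.le_add_left n i) (hn ▸ mem_top x))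

/-- Start at the top of the series and descend: once `⁅x, y⁆` is in a term, it commutes with `x`
modulo the preceding one, so its `q`-th power falls there, and isolation applies. For `i = 0`,
whatever commutes with `x ^ q` commutes with `x`. -/
theorem HasNoPrimeSetTorsion.commutatorElement_mem_upperCentralSeries [Group.IsNilpotent G]
    (hG : HasNoPrimeSetTorsion Q G) {q : ℕ} (hq : IsPrimeSetNumber Q q) {i : ℕ} {x y : G}
    (hxy : ⁅x ^ q, y⁆ ∈ Subgroup.upperCentralSeries G i) : ⁅x, y⁆ ∈ Subgroup.upperCentralSeries G i := by
  obtain ⟨n, hn⟩ := Group.IsNilpotent.nilpotent G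
  have key : ∀ k, ⁅x, y⁆ ∈ Subgroup.upperCentralSeries G (i + k) →
      ⁅x, y⁆ ∈ Subgroup.upperCentralSeries G i := by
    intro k
    induction k with
    | zero => exact id
    | succ k ih =>
      intro h
      exact ih (hG.mem_upperCentralSeries_of_pow_mem hq
        ((commutatorElement_pow_mem_iff (Subgroup.upperCentralSeries G (i + k)) (h x) q).1
          (Subgroup.upperCentralSeries_mono G (Nat.le_add_right i k) hxy)))
  exact key n (Subgroup.upperCentralSeries_mono G (Nat.le_add_left n i) (hn ▸ mem_top _))

/-- Roots are unique in nilpotent groups without `Q`-torsion. -/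
theorem HasNoPrimeSetTorsion.pow_left_injective [Group.IsNilpotent G]
    (hG : HasNoPrimeSetTorsion Q G) {q : ℕ} (hq : IsPrimeSetNumber Q q) {x y : G}
    (hxy : x ^ q = y ^ q) : x = y := by
  have h : ⁅x, y⁆ ∈ Subgroup.upperCentralSeries G 0 := by
    refine hG.commutatorElement_mem_upperCentralSeries hq ?_
    rw [hxy, commutatorElement_eq_one_iff_commute.2 (Commute.pow_self y q)]
    exact one_mem _
  have hc : Commute x y := commutatorElement_eq_one_iff_commute.1 (Subgroup.mem_bot.1 h)
  refine mul_inv_eq_one.1 (hG.eq_one_of_pow_eq_one hq ?_)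
  rw [hc.inv_right.mul_pow, inv_pow, hxy, mul_inv_cancel]

/-- If every element of a nilpotent group `G` without `Q`-torsion is a `Q`-root of an element of
the subgroup `Y`, then the upper central series of `Y` lies in that of `G`. -/
theorem HasNoPrimeSetTorsion.coe_mem_upperCentralSeries [Group.IsNilpotent G]
    (hG : HasNoPrimeSetTorsion Q G) {Y : Subgroup G} (hY : ∀ x, x ∈ Y.rootSet Q) (i : ℕ) {y : Y}
    (hy : y ∈ Subgroup.upperCentralSeries Y i) : (y : G) ∈ Subgroup.upperCentralSeries G i := by
  induction i generalizing y with
  | zero => exact Subgroup.mem_bot.2 (by rw [Subgroup.mem_bot.1 hy, coe_one])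
  | succ i ih =>
    intro g
    -- Centrality in `Y` controls only commutators with elements of `Y`, so `g` is replaced by `g ^
    -- q` and the exponent removed afterwards; the inversions put `g` in the first slot.
    obtain ⟨q, hq, hg⟩ := hY g
    rw [← commutatorElement_inv, inv_mem_iff]
    refine hG.commutatorElement_mem_upperCentralSeries hq ?_
    rw [← commutatorElement_inv, inv_mem_iff]
    exact ih (hy ⟨g ^ q, hg⟩)

theorem HasNoPrimeSetTorsion.upperCentralSeries_eq_top [Group.IsNilpotent G]
    (hG : HasNoPrimeSetTorsion Q G) {Y : Subgroup G} (hY : ∀ x, x ∈ Y.rootSet Q) {n : ℕ}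
    (hn : Subgroup.upperCentralSeries Y n = ⊤) : Subgroup.upperCentralSeries G n = ⊤ := by
  refine eq_top_iff.2 fun x _ => ?_
  obtain ⟨q, hq, hx⟩ := hY x
  have hx' : (⟨x ^ q, hx⟩ : Y) ∈ Subgroup.upperCentralSeries Y n := hn ▸ mem_top _
  exact hG.mem_upperCentralSeries_of_pow_mem hq (hG.coe_mem_upperCentralSeries hY n hx')

end UniqueRoots

/-! ### Nilpotent groups generated by roots -/

section RootSets

open Subgroup

variable {Q : Set ℕ} {G : Type*} [Group G]

/-- In a group that is abelian modulo `N` and generated by `Q`-roots modulo `YN`, all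
elements are such roots. -/
theorem exists_pow_mem_sup_of_closure {Y N : Subgroup G} [N.Normal]
    {S : Set G} (hcomm : ∀ a ∈ closure S, ∀ b ∈ closure S, ⁅a, b⁆ ∈ N)
    (hS : ∀ s ∈ S, ∃ q, IsPrimeSetNumber Q q ∧ s ^ q ∈ Y ⊔ N) {x : G}
    (hx : x ∈ closure S) : ∃ q, IsPrimeSetNumber Q q ∧ x ^ q ∈ Y ⊔ N := by
  induction hx using closure_induction with
  | mem x hx => exact hS x hx
  | one => exact ⟨1, .one, by simp⟩
  | inv x _ ih =>
    obtain ⟨q, hq, h⟩ := ih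
    exact ⟨q, hq, by rw [inv_pow]; exact inv_mem h⟩
  | mul a b ha hb iha ihb =>
    obtain ⟨m, hm, h⟩ := iha
    obtain ⟨n, hn, h'⟩ := ihb
    refine ⟨m * n, hm.mul hn, ?_⟩
    have hc : Commute (a : G ⧸ N) (b : G ⧸ N) := by
      rw [← commutatorElement_eq_one_iff_commute]
      exact (QuotientGroup.eq_one_iff (N := N) ⁅a, b⁆).2 (hcomm a ha b hb)
    have he : (((a ^ m) ^ n * (b ^ n) ^ m : G) : G ⧸ N) = ((a * b) ^ (m * n) : G) := by
      simp only [QuotientGroup.mk_mul, QuotientGroup.mk_pow]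
      rw [hc.mul_pow, ← pow_mul, ← pow_mul, mul_comm n m]
    have h1 := mul_mem (pow_mem h n) (pow_mem h' m)
    have h2 := QuotientGroup.eq.1 he
    rw [← mul_inv_cancel_left ((a ^ m) ^ n * (b ^ n) ^ m) ((a * b) ^ (m * n))]
    exact mul_mem h1 (mem_sup_right h2)

/-- Every element of a group generated by `Q`-roots of elements of `Y` has a `Q`-power in `Y`
modulo any given term of the lower central series. -/
theorem exists_pow_mem_sup_lowerCentralSeries {Y : Subgroup G}
    (hY : closure (Y.rootSet Q) = ⊤) (n : ℕ) (x : G) :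
    ∃ q, IsPrimeSetNumber Q q ∧ x ^ q ∈ Y ⊔ (⊤ : Subgroup G).lowerCentralSeries n := by
  induction n generalizing x with
  | zero => exact ⟨1, .one, by simp⟩
  | succ n ih =>
    set N := (⊤ : Subgroup G).lowerCentralSeries (n + 1) with hN
    have hcent : ∀ a ∈ (⊤ : Subgroup G).lowerCentralSeries n, ∀ g : G, ⁅a, g⁆ ∈ N :=
      fun a ha g => commutator_mem_commutator ha (mem_top g)
    -- The first factor is abelian and generated by the roots themselves. Later factors are
    -- generated by commutators with entries in the preceding term.
    cases n with
    | zero =>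
      refine exists_pow_mem_sup_of_closure (S := Y.rootSet Q)
        (fun a _ b _ => hcent a (mem_top a) b) ?_ (hY ▸ mem_top x)
      rintro s ⟨q, hq, h⟩
      exact ⟨q, hq, mem_sup_left h⟩
    | succ n =>
      set M := (⊤ : Subgroup G).lowerCentralSeries (n + 1) with hM
      have hK : ∀ k ∈ M, ∃ q, IsPrimeSetNumber Q q ∧ k ^ q ∈ Y ⊔ N := by
        intro k hk
        have hMc : M = closure {g | ∃ a ∈ (⊤ : Subgroup G).lowerCentralSeries n,
            ∃ b ∈ (⊤ : Subgroup G), ⁅a, b⁆ = g} := rfl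
        rw [hMc] at hk hcent
        refine exists_pow_mem_sup_of_closure (fun a ha b _ => hcent a ha b) ?_ hk
        rintro _ ⟨a, ha, b, -, rfl⟩
        have hab : ⁅a, b⁆ ∈ M := commutator_mem_commutator ha (mem_top b)
        rw [← hMc] at hcent
        -- Powers of `a` and `b` lie in `Y` modulo `M`. As `M` is central modulo `N`, the `M`-parts
        -- drop out of the commutator, and `⁅a, b⁆ ^ (p * q)` becomes `⁅y, y'⁆`.
        obtain ⟨p, hp, hap⟩ := ih a
        obtain ⟨q, hq, hbq⟩ := ih b
        obtain ⟨y, hy, z, hz, hyz⟩ := mem_sup_of_normal_right.1 hap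
        obtain ⟨y', hy', z', hz', hyz'⟩ := mem_sup_of_normal_right.1 hbq
        refine ⟨p * q, hp.mul hq, ?_⟩
        have hcen : ∀ c ∈ M, ∀ g : G ⧸ N, Commute (c : G ⧸ N) g := by
          intro c hc g
          obtain ⟨g, rfl⟩ := QuotientGroup.mk_surjective g
          rw [← commutatorElement_eq_one_iff_commute]
          exact (QuotientGroup.eq_one_iff (N := N) ⁅c, g⁆).2 (hcent c hc g)
        have e1 : ((⁅a, b⁆ : G) : G ⧸ N) ^ (p * q) = ((⁅y, y'⁆ : G) : G ⧸ N) := by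
          have c1 : ∀ g : G ⧸ N, Commute ⁅(a : G ⧸ N), (b : G ⧸ N)⁆ g := hcen _ hab
          have f1 : ⁅(a : G ⧸ N) ^ p, (b : G ⧸ N)⁆ = ⁅(a : G ⧸ N), (b : G ⧸ N)⁆ ^ p :=
            commutatorElement_pow_left (c1 _) p
          have f2 : ⁅(a : G ⧸ N) ^ p, (b : G ⧸ N) ^ q⁆ =
              ⁅(a : G ⧸ N) ^ p, (b : G ⧸ N)⁆ ^ q :=
            commutatorElement_pow_right (by rw [f1]; exact (c1 _).pow_left p) q
          have g1 : (a : G ⧸ N) ^ p = (z : G ⧸ N) * y := by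
            rw [(hcen z hz y).eq]; exact congrArg _ hyz.symm
          have g2 : (b : G ⧸ N) ^ q = (z' : G ⧸ N) * y' := by
            rw [(hcen z' hz' y').eq]; exact congrArg _ hyz'.symm
          have f3 : ⁅(z : G ⧸ N) * y, (z' : G ⧸ N) * y'⁆ = ⁅(y : G ⧸ N), (y' : G ⧸ N)⁆ := by
            have k1 := fun g => hcen z hz g
            have k2 := fun g => hcen z' hz' g
            have l1 : (z : G ⧸ N) ∈ center (G ⧸ N) := mem_center_iff.2 fun g => (k1 g).eq.symm
            have l2 : (z' : G ⧸ N) ∈ center (G ⧸ N) := mem_center_iff.2 fun g => (k2 g).eq.symm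
            simp only [commutatorElement_def, mul_inv_rev]
            calc (z : G ⧸ N) * y * (z' * y') * ((y : G ⧸ N)⁻¹ * (z : G ⧸ N)⁻¹) *
                  ((y' : G ⧸ N)⁻¹ * (z' : G ⧸ N)⁻¹)
                = (z : G ⧸ N) * (y * z') * y' * (y : G ⧸ N)⁻¹ *
                  ((z : G ⧸ N)⁻¹ * (y' : G ⧸ N)⁻¹) * (z' : G ⧸ N)⁻¹ := by group
              _ = (z : G ⧸ N) * (z' * y) * y' * (y : G ⧸ N)⁻¹ *
                  ((y' : G ⧸ N)⁻¹ * (z : G ⧸ N)⁻¹) * (z' : G ⧸ N)⁻¹ := by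
                rw [(k2 y).eq, ((k1 (y' : G ⧸ N)⁻¹).inv_left).eq]
              _ = (z : G ⧸ N) * z' * (y * y' * (y : G ⧸ N)⁻¹ * (y' : G ⧸ N)⁻¹) *
                  ((z' : G ⧸ N) * z)⁻¹ := by group
              _ = y * y' * (y : G ⧸ N)⁻¹ * (y' : G ⧸ N)⁻¹ := by
                rw [← (k2 z).eq, (((k2 _).mul_left (k1 _))).eq, mul_inv_cancel_right]
          rw [pow_mul]
          have : ((⁅a, b⁆ : G) : G ⧸ N) = ⁅(a : G ⧸ N), (b : G ⧸ N)⁆ := rfl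
          rw [this, ← f1, ← f2, g1, g2, f3]
          rfl
        have h2 := QuotientGroup.eq.1 (e1.symm.trans (QuotientGroup.mk_pow N _ _).symm)
        rw [← mul_inv_cancel_left ⁅y, y'⁆ (⁅a, b⁆ ^ (p * q))]
        refine mul_mem (mem_sup_left ?_) (mem_sup_right h2)
        exact mul_mem (mul_mem (mul_mem hy hy') (inv_mem hy)) (inv_mem hy')
      obtain ⟨q, hq, hx⟩ := ih x
      obtain ⟨y, hy, k, hk, hyk⟩ := mem_sup_of_normal_right.1 hx
      obtain ⟨r, hr, hkr⟩ := hK k hk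
      refine ⟨q * r, hq.mul hr, ?_⟩
      have hc : Commute (y : G ⧸ N) (k : G ⧸ N) := by
        rw [Commute.symm_iff, ← commutatorElement_eq_one_iff_commute]
        exact (QuotientGroup.eq_one_iff (N := N) ⁅k, y⁆).2 (hcent k hk y)
      have he : ((y ^ r * k ^ r : G) : G ⧸ N) = (x ^ (q * r) : G) := by
        rw [pow_mul, ← hyk]
        simp only [QuotientGroup.mk_mul, QuotientGroup.mk_pow]
        rw [hc.mul_pow]
      have h2 := QuotientGroup.eq.1 he
      rw [← mul_inv_cancel_left (y ^ r * k ^ r) (x ^ (q * r))]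
      exact mul_mem (mul_mem (mem_sup_left (pow_mem hy r)) hkr) (mem_sup_right h2)

/-- A nilpotent group generated by `Q`-roots of elements of a subgroup consists of such roots. -/
theorem mem_rootSet_of_closure_rootSet_eq_top [Group.IsNilpotent G] {Y : Subgroup G}
    (hY : closure (Y.rootSet Q) = ⊤) (x : G) : x ∈ Y.rootSet Q := by
  obtain ⟨n, hn⟩ := Subgroup.nilpotent_iff_lowerCentralSeries.1 ‹Group.IsNilpotent G›
  obtain ⟨q, hq, hx⟩ := exists_pow_mem_sup_lowerCentralSeries hY n x
  rw [hn, sup_bot_eq] at hx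
  exact ⟨q, hq, hx⟩

end RootSets

/-! ### Closure properties of C-bounded groups -/

namespace GroupClass

variable {C : GroupClass.{u}}

theorem torsion_bounds_of_injective {A B : Type u} [Group A] [Group B] (f : A →* B)
    (hf : Function.Injective f) {p : ℕ}
    (h : (∃ m : ℕ, 0 < m ∧ ∀ b ∈ primePowerTorsion p B, b ^ m = 1) ∧
      ∃ (G : Type u) (_ : Group G), C G ∧
        Cardinal.mk (primePowerTorsion p B) ≤ Cardinal.mk G) :
    (∃ m : ℕ, 0 < m ∧ ∀ b ∈ primePowerTorsion p A, b ^ m = 1) ∧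
      ∃ (G : Type u) (_ : Group G), C G ∧
        Cardinal.mk (primePowerTorsion p A) ≤ Cardinal.mk G := by
  obtain ⟨⟨m, hm, hB⟩, G, _, hG, hcard⟩ := h
  have hmap : ∀ a ∈ primePowerTorsion p A, f a ∈ primePowerTorsion p B := by
    rintro a ⟨k, hk⟩
    exact ⟨k, by rw [← map_pow, hk, map_one]⟩
  refine ⟨⟨m, hm, fun a ha => hf ?_⟩, G, _, hG, le_trans ?_ hcard⟩
  · rw [map_pow, map_one, hB _ (hmap a ha)]
  · refine Cardinal.mk_le_of_injective
      (f := fun a : primePowerTorsion p A => (⟨f a, hmap a a.2⟩ : primePowerTorsion p B)) ?_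
    intro a b hab
    exact Subtype.ext (hf (congrArg Subtype.val hab))

theorem boundedAbelian.of_injective {A B : Type u} [Group A] [Group B]
    (hB : C.boundedAbelian B) (f : A →* B) (hf : Function.Injective f) :
    C.boundedAbelian A := by
  refine ⟨fun a b => hf ?_, fun N _ p hp => ?_⟩
  · rw [map_mul, map_mul, hB.1]
  · have hN : (N.map f).Normal :=
      ⟨fun n hn g => by rwa [hB.1 g n, mul_inv_cancel_right]⟩
    refine torsion_bounds_of_injective
      (QuotientGroup.map N (N.map f) f (Subgroup.le_comap_map f N)) ?_ (hB.2 (N.map f) p hp)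
    rw [injective_iff_map_eq_one]
    intro a
    obtain ⟨a, rfl⟩ := QuotientGroup.mk_surjective a
    rw [QuotientGroup.map_mk, QuotientGroup.eq_one_iff, QuotientGroup.eq_one_iff]
    rintro ⟨b, hb, hab⟩
    exact hf hab ▸ hb

theorem boundedAbelian.of_surjective {A B : Type u} [Group A] [Group B]
    (hA : C.boundedAbelian A) (f : A →* B) (hf : Function.Surjective f) :
    C.boundedAbelian B := by
  refine ⟨fun a b => ?_, fun N _ p hp => ?_⟩
  · obtain ⟨a, rfl⟩ := hf a
    obtain ⟨b, rfl⟩ := hf b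
    rw [← map_mul, ← map_mul, hA.1]
  · let g : A ⧸ N.comap f →* B ⧸ N := QuotientGroup.map (N.comap f) N f le_rfl
    have hg : Function.Bijective g := by
      constructor
      · rw [injective_iff_map_eq_one]
        intro a
        obtain ⟨a, rfl⟩ := QuotientGroup.mk_surjective a
        rw [QuotientGroup.map_mk, QuotientGroup.eq_one_iff, QuotientGroup.eq_one_iff]
        exact id
      · intro b
        obtain ⟨b, rfl⟩ := QuotientGroup.mk_surjective b
        obtain ⟨a, rfl⟩ := hf b
        exact ⟨a, rfl⟩
    exact torsion_bounds_of_injective (MulEquiv.ofBijective g hg).symm.toMonoidHom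
      (MulEquiv.ofBijective g hg).symm.injective (hA.2 (N.comap f) p hp)

/-- The map induced by `f` on the factors is injective even when `f` is not, which lets projections
of a product be used. -/
theorem boundedAbelian.quotient_of_mem_iff {G H : Type u} [Group G] [Group H] (f : G →* H)
    {N K : Subgroup G} {N' K' : Subgroup H} [N.Normal] [N'.Normal]
    (hK : ∀ x ∈ K, f x ∈ K') (hN : ∀ x ∈ K, x ∈ N ↔ f x ∈ N')
    (h : C.boundedAbelian (K' ⧸ N'.subgroupOf K')) : C.boundedAbelian (K ⧸ N.subgroupOf K) := by
  let g : K →* K' := (f.comp K.subtype).codRestrict K' fun x => hK x x.2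
  have hg : ∀ x : K, x ∈ N.subgroupOf K ↔ g x ∈ N'.subgroupOf K' := fun x => hN x x.2
  have hle : N.subgroupOf K ≤ (N'.subgroupOf K').comap g := fun x hx => (hg x).1 hx
  refine h.of_injective (QuotientGroup.map _ _ g hle) ?_
  rw [injective_iff_map_eq_one]
  intro a
  obtain ⟨a, rfl⟩ := QuotientGroup.mk_surjective a
  rw [QuotientGroup.map_mk, QuotientGroup.eq_one_iff, QuotientGroup.eq_one_iff]
  exact (hg a).2

theorem boundedNilpotent.of_injective {G H : Type u} [Group G] [Group H]
    (hH : C.boundedNilpotent H) (f : G →* H) (hf : Function.Injective f) :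
    C.boundedNilpotent G := by
  obtain ⟨hnil, n, K, hKn, h0, hn, hK⟩ := hH
  refine ⟨?_, n, fun i => (K i).comap f, fun i => inferInstance, ?_, ?_, fun i hi => ?_⟩
  · exact Subgroup.isNilpotent_of_ker_le_center f
      (by rw [(MonoidHom.ker_eq_bot_iff f).2 hf]; exact bot_le)
  · simp only [h0]
    exact (MonoidHom.ker_eq_bot_iff f).2 hf
  · simp only [hn, Subgroup.comap_top]
  · obtain ⟨hle, hcen, hb⟩ := hK i hi
    refine ⟨Subgroup.comap_mono hle, fun x hx g => ?_, ?_⟩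
    · simpa using hcen (f x) hx (f g)
    · exact boundedAbelian.quotient_of_mem_iff f (fun x hx => hx) (fun x _ => Iff.rfl) hb

theorem boundedNilpotent.of_surjective {G H : Type u} [Group G] [Group H]
    (hG : C.boundedNilpotent G) (f : G →* H) (hf : Function.Surjective f) :
    C.boundedNilpotent H := by
  obtain ⟨hnil, n, K, hKn, h0, hn, hK⟩ := hG
  refine ⟨?_, n, fun i => (K i).map f, fun i => (hKn i).map f hf, ?_, ?_, fun i hi => ?_⟩
  · exact Group.nilpotent_of_surjective f hf
  · simp only [h0, Subgroup.map_bot]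
  · simp only [hn]
    exact Subgroup.map_top_of_surjective f hf
  · obtain ⟨hle, hcen, hb⟩ := hK i hi
    refine ⟨Subgroup.map_mono hle, ?_, ?_⟩
    · rintro _ ⟨x, hx, rfl⟩ g
      obtain ⟨g, rfl⟩ := hf g
      exact ⟨_, hcen x hx g, by simp⟩
    · have := (hKn i).map f hf
      have hle' : (K i).subgroupOf (K (i + 1)) ≤
          (((K i).map f).subgroupOf ((K (i + 1)).map f)).comap (f.subgroupMap (K (i + 1))) :=
        fun x hx => Subgroup.mem_map_of_mem f (Subgroup.mem_subgroupOf.1 hx)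
      refine hb.of_surjective (QuotientGroup.map _ _ _ hle') ?_
      intro y
      obtain ⟨⟨_, x, hx, rfl⟩, rfl⟩ := QuotientGroup.mk_surjective y
      exact ⟨((⟨x, hx⟩ : K (i + 1)) : K (i + 1) ⧸ (K i).subgroupOf (K (i + 1))), rfl⟩

theorem boundedNilpotent.prod {G H : Type u} [Group G] [Group H]
    (hG : C.boundedNilpotent G) (hH : C.boundedNilpotent H) : C.boundedNilpotent (G × H) := by
  obtain ⟨hnil, n, K, hKn, h0, hn, hK⟩ := hG
  obtain ⟨hnil', n', K', hKn', h0', hn', hK'⟩ := hH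
  -- The series climbs through `G` first, then through `H`: truncated subtraction keeps the second
  -- factor at `K' 0` until `i` passes `n`, and `min` freezes the first at `K n`.
  refine ⟨inferInstance, n + n', fun i => (K (min i n)).prod (K' (i - n)),
    fun i => inferInstance, ?_, ?_, fun i hi => ?_⟩
  · simp [h0, h0']
  · simp [hn, hn']
  · rcases lt_or_ge i n with hin | hin
    · obtain ⟨hle, hcen, hb⟩ := hK i hin
      have e1 : min i n = i := by omega
      have e2 : min (i + 1) n = i + 1 := by omega
      have e3 : i - n = 0 := by omega
      have e4 : i + 1 - n = 0 := by omega
      simp only [e1, e2, e3, e4, h0']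
      refine ⟨Subgroup.prod_mono hle le_rfl, ?_, ?_⟩
      · rintro ⟨x, y⟩ ⟨hx, hy⟩ ⟨g, k⟩
        have hy' : y = 1 := hy
        exact ⟨hcen x hx g, by simp [hy']⟩
      · refine boundedAbelian.quotient_of_mem_iff (MonoidHom.fst G H)
          (N' := K i) (K' := K (i + 1)) (fun x hx => by simpa [e2] using hx.1)
          (fun x hx => ⟨fun h => by simpa [e1] using h.1, fun h => ⟨by simpa [e1] using h, by simpa [e3, e4, h0'] using hx.2⟩⟩) hb
    · obtain ⟨hle, hcen, hb⟩ := hK' (i - n) (by omega)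
      have e1 : min i n = n := by omega
      have e2 : min (i + 1) n = n := by omega
      have e3 : i + 1 - n = i - n + 1 := by omega
      simp only [e1, e2, e3, hn]
      refine ⟨Subgroup.prod_mono le_rfl hle, ?_, ?_⟩
      · rintro ⟨x, y⟩ ⟨hx, hy⟩ ⟨g, k⟩
        exact ⟨Subgroup.mem_top _, hcen y hy k⟩
      · refine boundedAbelian.quotient_of_mem_iff (MonoidHom.snd G H)
          (N' := K' (i - n)) (K' := K' (i - n + 1)) (fun x hx => by simpa [e3] using hx.2)
          (fun x hx => ⟨fun h => h.2, fun h => ⟨by simp [e1, hn], h⟩⟩) hb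

theorem boundedNilpotentTorsionFree.of_injective {G H : Type u} [Group G] [Group H]
    (hH : C.boundedNilpotentTorsionFree H) (f : G →* H) (hf : Function.Injective f) :
    C.boundedNilpotentTorsionFree G :=
  ⟨hH.1.of_injective f hf, hH.2.of_injective f hf⟩

/-- The elements of `p`-power order of a `C`-bounded nilpotent group have bounded order. -/
theorem boundedNilpotent.exists_pow_eq_one {G : Type u} [Group G] (hG : C.boundedNilpotent G)
    {p : ℕ} (hp : p ∈ C.primes) :
    ∃ m, 0 < m ∧ ∀ x ∈ primePowerTorsion p G, x ^ m = 1 := by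
  obtain ⟨hnil, n, K, hKn, h0, hn, hK⟩ := hG
  have key : ∀ i ≤ n, ∃ m, 0 < m ∧ ∀ x ∈ primePowerTorsion p G, x ∈ K i → x ^ m = 1 := by
    intro i
    induction i with
    | zero => exact fun _ => ⟨1, one_pos, fun x _ hx => by
        rw [h0, Subgroup.mem_bot] at hx; rw [hx, one_pow]⟩
    | succ i ih =>
      intro hi
      obtain ⟨m, hm, h⟩ := ih (by omega)
      obtain ⟨hle, hcen, hb⟩ := hK i (by omega)
      obtain ⟨l, hl, h'⟩ := (torsion_bounds_of_injective (C := C)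
        (QuotientGroup.quotientBot (G := K (i + 1) ⧸ (K i).subgroupOf
          (K (i + 1)))).symm.toMonoidHom (MulEquiv.injective _) (hb.2 ⊥ p hp)).1
      refine ⟨l * m, Nat.mul_pos hl hm, fun x hx hxi => ?_⟩
      obtain ⟨k, hk⟩ := hx
      rw [pow_mul]
      refine h _ ⟨k, by rw [← pow_mul, mul_comm, pow_mul, hk, one_pow]⟩ ?_
      have := h' ((⟨x, hxi⟩ : K (i + 1)) : K (i + 1) ⧸ (K i).subgroupOf (K (i + 1)))
        ⟨k, by
          rw [← QuotientGroup.mk_pow, QuotientGroup.eq_one_iff, Subgroup.mem_subgroupOf]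
          simp [hk]⟩
      rw [← QuotientGroup.mk_pow, QuotientGroup.eq_one_iff, Subgroup.mem_subgroupOf] at this
      simpa using this
  obtain ⟨m, hm, h⟩ := key n le_rfl
  exact ⟨m, hm, fun x hx => h x hx (hn ▸ Subgroup.mem_top x)⟩

end GroupClass

/-! ### Bounded groups of p-power exponent lie in C -/

namespace GroupClass

variable {C : GroupClass.{u}}

theorem IsRoot.of_injective (hC : C.IsRoot) {G H : Type u} [Group G] [Group H] (hH : C H)
    (f : G →* H) (hf : Function.Injective f) : C G :=
  hC.of_mulEquiv f.range G (hC.subgroup H f.range hH) ⟨(MonoidHom.ofInjective hf).symm⟩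

theorem IsRoot.of_subsingleton (hC : C.IsRoot) {G : Type u} [Group G] [Subsingleton G] : C G := by
  obtain ⟨H, _, hH, -⟩ := hC.exists_nontrivial
  exact hC.of_injective hH 1 (Function.injective_of_subsingleton _)

theorem IsRoot.exists_mem_primes (hC : C.IsRoot) (hper : C.IsPeriodic) : ∃ p, p ∈ C.primes := by
  obtain ⟨G, _, hG, _⟩ := hC.exists_nontrivial
  obtain ⟨g, hg⟩ := exists_ne (1 : G)
  obtain ⟨p, hp, hd⟩ := Nat.exists_prime_and_dvd (mt orderOf_eq_one_iff.1 hg)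
  exact ⟨p, hp, G, _, hG, g, hper G hG g, hd⟩

theorem IsRoot.exists_cyclic (hC : C.IsRoot) {p : ℕ} (hp : p ∈ C.primes) :
    ∃ (K : Type u) (_ : Group K), C K ∧ Nonempty (Multiplicative (ZMod p) ≃* K) := by
  obtain ⟨hp, G, _, hG, g, hg, hd⟩ := hp
  have hcard : Nat.card (Subgroup.zpowers (g ^ (orderOf g / p))) = p := by
    rw [Nat.card_zpowers]
    exact orderOf_pow_orderOf_div hg.orderOf_pos.ne' hd
  refine ⟨Subgroup.zpowers (g ^ (orderOf g / p)), inferInstance, hC.subgroup G _ hG, ?_⟩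
  have e := zmodCyclicMulEquiv
    (inferInstance : IsCyclic (Subgroup.zpowers (g ^ (orderOf g / p))))
  rw [hcard] at e
  exact ⟨e⟩

/-- Coordinates in an 𝔽_p-basis embed `A` in a power of a cyclic group of order `p`. The basis
injects into `G`, so extension by 1 lands in a Cartesian power indexed by `G`. -/
theorem IsRoot.of_elementary (hC : C.IsRoot) {p : ℕ} (hp : p ∈ C.primes)
    {A G : Type u} [CommGroup A] [Group G] (hA : ∀ a : A, a ^ p = 1) (hG : C G)
    (hcard : Cardinal.mk A ≤ Cardinal.mk G) : C A := by
  obtain ⟨K, _, hK, ⟨e⟩⟩ := hC.exists_cyclic hp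
  have : Fact p.Prime := ⟨hp.1⟩
  let _ : Module (ZMod p) (Additive A) := AddCommGroup.zmodModule (n := p) hA
  let b := Module.Basis.ofVectorSpace (ZMod p) (Additive A)
  obtain ⟨j⟩ : Nonempty (Module.Basis.ofVectorSpaceIndex (ZMod p) (Additive A) ↪ G) :=
    (Cardinal.mk_set_le _).trans hcard
  let f : A →* (Module.Basis.ofVectorSpaceIndex (ZMod p) (Additive A) → K) :=
    { toFun := fun a i => e (Multiplicative.ofAdd (b.repr (Additive.ofMul a) i))
      map_one' := by ext i; simp
      map_mul' := fun x y => by ext i; simp }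
  refine hC.of_injective (hC.cartesianPower K G hK hG)
    ((Function.ExtendByOne.hom K j).comp f) ?_
  intro x y hxy
  have h1 : f x = f y := by
    ext i
    have := congrFun hxy (j i)
    simpa [Function.ExtendByOne.hom, j.injective.extend_apply] using this
  have h2 : b.repr (Additive.ofMul x) = b.repr (Additive.ofMul y) := by
    ext i
    exact Multiplicative.ofAdd.injective (e.injective (congrFun h1 i))
  exact Additive.ofMul.injective (b.repr.injective h2)

/-- The `p`-th power map exhibits `A` as an extension of an elementary kernel by an image of smaller
exponent, neither larger than `A` in cardinality. -/
theorem IsRoot.of_commGroup_of_pow_eq_one (hC : C.IsRoot) {p : ℕ} (hp : p ∈ C.primes)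
    {A G : Type u} [CommGroup A] [Group G] (k : ℕ) (hA : ∀ a : A, a ^ p ^ k = 1) (hG : C G)
    (hcard : Cardinal.mk A ≤ Cardinal.mk G) : C A := by
  induction k generalizing A with
  | zero =>
    have : Subsingleton A := ⟨fun a b => by
      have ha := hA a
      have hb := hA b
      simp only [pow_zero, pow_one] at ha hb
      rw [ha, hb]⟩
    exact hC.of_subsingleton
  | succ k ih =>
    let f : A →* A := powMonoidHom p
    refine hC.extension A f.ker ?_ ?_
    · refine hC.of_elementary hp (fun a => ?_) hG ((Cardinal.mk_set_le _).trans hcard)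
      exact Subtype.ext a.2
    · refine hC.of_mulEquiv f.range _ (ih ?_ ((Cardinal.mk_set_le _).trans hcard))
        ⟨(QuotientGroup.quotientKerEquivRange f).symm⟩
      rintro ⟨_, a, rfl⟩
      refine Subtype.ext ?_
      change (a ^ p) ^ p ^ k = 1
      rw [← pow_mul, ← pow_succ', hA]

theorem IsRoot.of_boundedAbelian (hC : C.IsRoot) {p : ℕ} (hp : p ∈ C.primes)
    {A : Type u} [Group A] (hA : C.boundedAbelian A) (k : ℕ) (hk : ∀ a : A, a ^ p ^ k = 1) :
    C A := by
  obtain ⟨-, G, _, hG, hcard⟩ := torsion_bounds_of_injective (C := C)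
    (QuotientGroup.quotientBot (G := A)).symm.toMonoidHom (MulEquiv.injective _) (hA.2 ⊥ p hp)
  have htors : primePowerTorsion p A = Set.univ := Set.eq_univ_of_forall fun a => ⟨k, hk a⟩
  rw [htors, Cardinal.mk_univ] at hcard
  let _ : CommGroup A := { ‹Group A› with mul_comm := hA.1 }
  exact hC.of_commGroup_of_pow_eq_one hp k hk hG hcard

theorem IsRoot.of_boundedNilpotent (hC : C.IsRoot) {p : ℕ} (hp : p ∈ C.primes)
    {G : Type u} [Group G] (hG : C.boundedNilpotent G) (k : ℕ) (hk : ∀ g : G, g ^ p ^ k = 1) :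
    C G := by
  obtain ⟨-, n, K, hKn, h0, hn, hK⟩ := hG
  have key : ∀ i ≤ n, C (K i) := by
    intro i
    induction i with
    | zero =>
      intro _
      rw [h0]
      exact hC.of_subsingleton
    | succ i ih =>
      intro hi
      obtain ⟨hle, -, hb⟩ := hK i (by omega)
      refine hC.extension _ ((K i).subgroupOf (K (i + 1))) ?_ ?_
      · exact hC.of_mulEquiv _ _ (ih (by omega)) ⟨(Subgroup.subgroupOfEquivOfLe hle).symm⟩
      · refine hC.of_boundedAbelian hp hb k fun a => ?_
        obtain ⟨a, rfl⟩ := QuotientGroup.mk_surjective a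
        rw [← QuotientGroup.mk_pow, QuotientGroup.eq_one_iff, Subgroup.mem_subgroupOf]
        simp [hk]
  have := key n le_rfl
  rw [hn] at this
  exact hC.of_mulEquiv _ _ this ⟨Subgroup.topEquiv⟩

end GroupClass

/-! ### Exponent of a nilpotent group from its center -/

/-- If the center of `G` has exponent dividing `m`, so have the factors of the upper central
series. -/
theorem pow_mem_upperCentralSeries_of_mem_succ {G : Type*} [Group G] {m : ℕ}
    (hm : ∀ z ∈ Subgroup.center G, z ^ m = 1) (i : ℕ) {x : G}
    (hx : x ∈ Subgroup.upperCentralSeries G (i + 1)) :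
    x ^ m ∈ Subgroup.upperCentralSeries G i := by
  induction i generalizing x with
  | zero =>
    rw [zero_add, Subgroup.upperCentralSeries_one] at hx
    exact Subgroup.mem_bot.2 (hm x hx)
  | succ i ih =>
    intro g
    exact (commutatorElement_pow_mem_iff (Subgroup.upperCentralSeries G i) (hx g x) m).2
      (ih (hx g))

theorem Group.IsNilpotent.exists_forall_pow_eq_one {G : Type*} [Group G] [Group.IsNilpotent G]
    {m : ℕ} (hm : ∀ z ∈ Subgroup.center G, z ^ m = 1) : ∃ n, ∀ x : G, x ^ m ^ n = 1 := by
  obtain ⟨n, hn⟩ := Group.IsNilpotent.nilpotent G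
  have key : ∀ i, ∀ x ∈ Subgroup.upperCentralSeries G i, x ^ m ^ i = 1 := by
    intro i
    induction i with
    | zero => exact fun x hx => by rw [Subgroup.mem_bot.1 hx, one_pow]
    | succ i ih =>
      intro x hx
      rw [pow_succ', pow_mul]
      exact ih _ (pow_mem_upperCentralSeries_of_mem_succ hm i hx)
  exact ⟨n, fun x => key n x (hn ▸ Subgroup.mem_top x)⟩

theorem IsPrimeSetNumber.not_dvd {C : GroupClass.{u}} {p q : ℕ} (hp : p ∈ C.primes)
    (hq : IsPrimeSetNumber C.primesCompl q) : ¬ p ∣ q :=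
  fun h => (hq.2 p hp.1 h).2 hp

/-! ### Separation by nilpotent C-groups -/

namespace GroupClass

variable {C : GroupClass.{u}}

/-- A `C`-bounded nilpotent group belongs to `C` if it has an element none of whose
`𝔓(C)′`-powers lies in a given subgroup `Y`, while every non-trivial normal subgroup `M` contains
such a power modulo `Y`. -/
theorem IsRoot.of_boundedNilpotent_of_forall_normal (hC : C.IsRoot) (hper : C.IsPeriodic)
    {R : Type u} [Group R] (hR : C.boundedNilpotent R) {Y : Subgroup R} {a : R}
    (hY : ∀ q, IsPrimeSetNumber C.primesCompl q → a ^ q ∉ Y)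
    (hM : ∀ M : Subgroup R, M.Normal → M ≠ ⊥ →
      ∃ q, IsPrimeSetNumber C.primesCompl q ∧ a ^ q ∈ Y ⊔ M) : C R := by
  have hnil : Group.IsNilpotent R := hR.1
  rcases subsingleton_or_nontrivial R with _ | _
  · exact hC.of_subsingleton
  have hnorm : ∀ z ∈ Subgroup.center R, (Subgroup.zpowers z).Normal := fun z hz =>
    ⟨fun w hw g => by
      have hw' : w ∈ Subgroup.center R := Subgroup.zpowers_le.2 hz hw
      rwa [Subgroup.mem_center_iff.1 hw' g, mul_inv_cancel_right]⟩
  have hYZ : ∀ z ∈ Subgroup.center R, z ∈ Y → z = 1 := by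
    intro z hz hzY
    by_contra hz1
    obtain ⟨q, hq, h⟩ := hM _ (hnorm z hz) (mt Subgroup.zpowers_eq_bot.1 hz1)
    rw [sup_eq_left.2 (Subgroup.zpowers_le.2 hzY)] at h
    exact hY q hq h
  have hroot : ∀ z ∈ Subgroup.center R, z ≠ 1 →
      ∃ q, IsPrimeSetNumber C.primesCompl q ∧ ∃ y ∈ Y, ∃ i : ℤ, a ^ q = y * z ^ i := by
    intro z hz hz1
    have := hnorm z hz
    obtain ⟨q, hq, h⟩ := hM _ (hnorm z hz) (mt Subgroup.zpowers_eq_bot.1 hz1)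
    obtain ⟨y, hy, w, ⟨i, rfl⟩, h⟩ := Subgroup.mem_sup_of_normal_right.1 h
    exact ⟨q, hq, y, hy, i, h.symm⟩
  -- Both expressions are raised to the common power `a ^ (q * q')`; the central discrepancy lies in
  -- `Y`, which meets the center trivially.
  have hcompare : ∀ z ∈ Subgroup.center R, ∀ z' ∈ Subgroup.center R, ∀ y ∈ Y, ∀ y' ∈ Y,
      ∀ q q' : ℕ, a ^ q = y * z → a ^ q' = y' * z' → z ^ q' = z' ^ q := by
    intro z hz z' hz' y hy y' hy' q q' h h'
    have hc : Commute y z := Subgroup.mem_center_iff.1 hz y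
    have hc' : Commute y' z' := Subgroup.mem_center_iff.1 hz' y'
    have e : y ^ q' * z ^ q' = y' ^ q * z' ^ q := by
      rw [← hc.mul_pow, ← hc'.mul_pow, ← h, ← h', ← pow_mul, ← pow_mul, mul_comm]
    have e' : z ^ q' * (z' ^ q)⁻¹ = (y ^ q')⁻¹ * y' ^ q := by
      rw [mul_inv_eq_iff_eq_mul, mul_assoc, ← e, inv_mul_cancel_left]
    refine mul_inv_eq_one.1 (hYZ _ (mul_mem (pow_mem hz _) (inv_mem (pow_mem hz' _))) ?_)
    rw [e']
    exact mul_mem (inv_mem (pow_mem hy _)) (pow_mem hy' _)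
  have hfin : ∀ z ∈ Subgroup.center R, IsOfFinOrder z := by
    intro z hz
    by_contra hz0
    have hzpow : ∀ n : ℤ, z ^ n = 1 → n = 0 := fun n hn => by
      by_contra h
      exact hz0 (isOfFinOrder_iff_zpow_eq_one.2 ⟨n, h, hn⟩)
    obtain ⟨p, hp⟩ := hC.exists_mem_primes hper
    obtain ⟨q, hq, y, hy, i, h⟩ := hroot z hz fun h => hz0 (h ▸ IsOfFinOrder.one)
    have hi : i ≠ 0 := by
      rintro rfl
      refine hY q hq ?_
      rw [h, zpow_zero, mul_one]
      exact hy
    have hip : i * p ≠ 0 := mul_ne_zero hi (Int.natCast_ne_zero.2 hp.1.ne_zero)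
    -- Comparing `z` with its power `z ^ (i * p)` forces `q' = p * j * q` when `z` has infinite
    -- order, so `p` would divide a 𝔓(C)′-number.
    obtain ⟨q', hq', y', hy', j, h'⟩ :=
      hroot (z ^ (i * p)) (zpow_mem hz _) fun h => hip (hzpow _ h)
    have e := hcompare _ (zpow_mem hz i) _ (zpow_mem (zpow_mem hz (i * p)) j) y hy y' hy'
      q q' h h'
    simp only [← zpow_natCast, ← zpow_mul] at e
    have e2 := hzpow (i * q' - i * p * j * q) (by rw [zpow_sub, e, mul_inv_cancel])
    have e3 : (q' : ℤ) = p * (j * q) := by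
      apply mul_left_cancel₀ hi
      linear_combination e2
    exact hq'.not_dvd hp (Int.natCast_dvd_natCast.1 ⟨_, e3⟩)
  have hprime : ∀ z ∈ Subgroup.center R, ∀ p : ℕ, p.Prime → orderOf z = p → p ∈ C.primes := by
    intro z hz p hp hzp
    by_contra hpC
    obtain ⟨q, hq, y, hy, i, h⟩ := hroot z hz fun h => hp.one_lt.ne (by rw [← hzp, h, orderOf_one])
    -- If `p` were outside 𝔓(C), the exponent `q * p` would be admissible, and it kills the central
    -- part of `a ^ q`.
    refine hY (q * p) (hq.mul (.of_prime hp ⟨hp, hpC⟩)) ?_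
    have hc : Commute y (z ^ i) := Subgroup.mem_center_iff.1 (zpow_mem hz i) y
    rw [pow_mul, h, hc.mul_pow, ← zpow_natCast (z ^ i), zpow_comm, zpow_natCast, ← hzp,
      pow_orderOf_eq_one, one_zpow, mul_one]
    exact pow_mem hy _
  have hprimeOrder : ∀ z ∈ Subgroup.center R, ∀ p : ℕ, p.Prime → p ∣ orderOf z →
      ∃ w ∈ Subgroup.center R, orderOf w = p := fun z hz p hp hd =>
    ⟨z ^ (orderOf z / p), pow_mem hz _, orderOf_pow_orderOf_div (hfin z hz).orderOf_pos.ne' hd⟩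
  obtain ⟨⟨z₀, hz₀⟩, hz₀1⟩ :=
    Subgroup.ne_bot_iff_exists_ne_one.1 (Group.IsNilpotent.center_ne_bot R)
  replace hz₀1 : z₀ ≠ 1 := fun h => hz₀1 (Subtype.ext h)
  obtain ⟨p, hpp, hpd⟩ := Nat.exists_prime_and_dvd (mt orderOf_eq_one_iff.1 hz₀1)
  obtain ⟨z, hz, hzp⟩ := hprimeOrder _ hz₀ p hpp hpd
  have hp : p ∈ C.primes := hprime z hz p hpp hzp
  have hpgroup : ∀ w ∈ Subgroup.center R, ∃ k, orderOf w = p ^ k := by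
    intro w hw
    refine ⟨_, Nat.eq_prime_pow_of_unique_prime_dvd (hfin w hw).orderOf_pos.ne' ?_⟩
    intro l hl hld
    by_contra hlp
    obtain ⟨v, hv, hvl⟩ := hprimeOrder w hw l hl hld
    obtain ⟨q, hq, y, hy, i, h⟩ := hroot z hz fun h => hpp.one_lt.ne (by rw [← hzp, h, orderOf_one])
    obtain ⟨q', hq', y', hy', j, h'⟩ :=
      hroot v hv fun h => hl.one_lt.ne (by rw [← hvl, h, orderOf_one])
    -- Central elements of distinct prime orders `p` and `l` cannot coexist: a power of `z` equals a
    -- power of `v`, so `p` divides `i * q' * l`, and each factor is excluded.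
    have e := hcompare _ (zpow_mem hz i) _ (zpow_mem hv j) y hy y' hy' q q' h h'
    have e1 : (v ^ j) ^ l = 1 := by
      rw [← zpow_natCast, zpow_comm, zpow_natCast, ← hvl, pow_orderOf_eq_one, one_zpow]
    have e2 : z ^ (i * (q' * l : ℕ)) = 1 := by
      rw [zpow_mul, zpow_natCast, pow_mul, e, ← pow_mul, mul_comm, pow_mul, e1, one_pow]
    rw [← orderOf_dvd_iff_zpow_eq_one, hzp] at e2
    rcases (Nat.prime_iff_prime_int.1 hpp).dvd_or_dvd e2 with h2 | h2
    · rw [← hzp, orderOf_dvd_iff_zpow_eq_one] at h2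
      refine hY q hq ?_
      rw [h, h2, mul_one]
      exact hy
    · rcases hpp.dvd_mul.1 (Int.natCast_dvd_natCast.1 h2) with h3 | h3
      · exact hq'.not_dvd hp h3
      · exact hlp ((Nat.prime_dvd_prime_iff_eq hpp hl).1 h3).symm
  obtain ⟨m, hm, hmt⟩ := hR.exists_pow_eq_one hp
  -- Central orders are powers of `p`, so only the `p`-part of the bound `m` matters.
  obtain ⟨j, m', hm', rfl⟩ := Nat.exists_eq_pow_mul_and_not_dvd hm.ne' p hpp.ne_one
  have hexp : ∀ w ∈ Subgroup.center R, w ^ p ^ j = 1 := by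
    intro w hw
    obtain ⟨k, hk⟩ := hpgroup w hw
    have h1 := hmt w ⟨k, by rw [← hk, pow_orderOf_eq_one]⟩
    rw [← orderOf_dvd_iff_pow_eq_one] at h1 ⊢
    refine Nat.Coprime.dvd_of_dvd_mul_right ?_ h1
    rw [hk]
    exact Nat.Coprime.pow_left k ((Nat.Prime.coprime_iff_not_dvd hpp).2 hm')
  obtain ⟨n, hn⟩ := Group.IsNilpotent.exists_forall_pow_eq_one hexp
  exact hC.of_boundedNilpotent hp hR (j * n) fun g => by rw [pow_mul, hn]

/-- In a `C`-bounded nilpotent group, an element that is not a `𝔓(C)′`-root of an element of `Y`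
can be separated from `Y` by a normal subgroup whose quotient belongs to `C`. -/
theorem boundedNilpotent.exists_normal (hC : C.IsRoot) (hper : C.IsPeriodic)
    {G : Type u} [Group G] (hG : C.boundedNilpotent G) {Y : Subgroup G} {a : G}
    (ha : a ∉ Y.rootSet C.primesCompl) :
    ∃ (N : Subgroup G) (_ : N.Normal), C (G ⧸ N) ∧ a ∉ Y ⊔ N := by
  obtain ⟨N, -, ⟨hN, hNa⟩, hmax⟩ := zorn_le_nonempty₀
    {N : Subgroup G | N.Normal ∧ ∀ q, IsPrimeSetNumber C.primesCompl q → a ^ q ∉ Y ⊔ N}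
    (fun c hc hchain M hMc => by
      have hdir : DirectedOn (· ≤ ·) c := hchain.directedOn
      have hnorm : (sSup c).Normal := ⟨fun n hn g => by
        obtain ⟨K, hK, hnK⟩ := (Subgroup.mem_sSup_of_directedOn ⟨M, hMc⟩ hdir).1 hn
        exact (Subgroup.mem_sSup_of_directedOn ⟨M, hMc⟩ hdir).2
          ⟨K, hK, (hc hK).1.conj_mem n hnK g⟩⟩
      refine ⟨sSup c, ⟨hnorm, fun q hq h => ?_⟩, fun K hK => le_sSup hK⟩
      obtain ⟨y, hy, n, hn, e⟩ := Subgroup.mem_sup_of_normal_right.1 h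
      obtain ⟨K, hK, hnK⟩ := (Subgroup.mem_sSup_of_directedOn ⟨M, hMc⟩ hdir).1 hn
      refine (hc hK).2 q hq ?_
      rw [← e]
      exact mul_mem (Subgroup.mem_sup_left hy) (Subgroup.mem_sup_right hnK))
    ⊥ ⟨inferInstance, fun q hq h => ha ⟨q, hq, by rwa [sup_bot_eq] at h⟩⟩
  refine ⟨N, hN, ?_, fun h => hNa 1 .one (by rwa [pow_one])⟩
  refine hC.of_boundedNilpotent_of_forall_normal hper
    (hG.of_surjective (QuotientGroup.mk' N) (QuotientGroup.mk'_surjective N))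
    (Y := Y.map (QuotientGroup.mk' N)) (a := QuotientGroup.mk' N a) (fun q hq h => ?_)
    (fun M hM hM1 => ?_)
  · refine hNa q hq ?_
    rw [← map_pow, ← Subgroup.mem_comap, Subgroup.comap_map_eq, QuotientGroup.ker_mk'] at h
    exact h
  -- If `M` violated the condition, its preimage would still avoid all the powers of `a`; maximality
  -- of `N` then makes `M` trivial.
  · by_contra! hcon
    refine hM1 (eq_bot_iff.2 fun x hx => ?_)
    obtain ⟨x, rfl⟩ := QuotientGroup.mk'_surjective N x
    refine Subgroup.mem_bot.2 ((QuotientGroup.eq_one_iff x).2 ?_)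
    refine hmax (y := M.comap (QuotientGroup.mk' N)) ⟨inferInstance, fun q hq h => ?_⟩
      (QuotientGroup.le_comap_mk' N M) hx
    refine hcon q hq ?_
    have h' := Subgroup.mem_map_of_mem (QuotientGroup.mk' N) h
    rw [Subgroup.map_sup, map_pow] at h'
    exact sup_le_sup_left (Subgroup.map_comap_le _ _) _ h'

/-- In a residually `𝓑`-group, a `𝔓(C)′`-isolated subgroup that embeds into a `𝓑`-image of the
group is separable by the nilpotent `C`-groups. -/
theorem isSeparable_nilpotentPart_of_isIsolated (hC : C.IsRoot) (hper : C.IsPeriodic)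
    {X : Type u} [Group X] (hX : C.boundedNilpotentTorsionFree.IsResidually X)
    {I : Subgroup X} (hI : I.IsIsolated C.primesCompl)
    {Z : Type u} [Group Z] (hZ : C.boundedNilpotentTorsionFree Z)
    (σ : X →* Z) (hσ : Function.Surjective σ) (hσI : Set.InjOn σ (I : Set X)) :
    C.nilpotentPart.IsSeparable I := by
  intro x hx
  suffices h : ∃ (P : Type u) (_ : Group P) (ρ : X →* P), C.boundedNilpotent P ∧
      Function.Surjective ρ ∧ ρ x ∉ (I.map ρ).rootSet C.primesCompl by
    obtain ⟨P, _, ρ, hP, hρ, hxρ⟩ := h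
    obtain ⟨N, _, hN, hxN⟩ := hP.exists_normal hC hper hxρ
    have hnil : Group.IsNilpotent P := hP.1
    refine ⟨P ⧸ N, inferInstance, (QuotientGroup.mk' N).comp ρ, ⟨inferInstance, hN⟩,
      (QuotientGroup.mk'_surjective N).comp hρ, fun h => hxN ?_⟩
    rw [← Subgroup.map_map] at h
    change ρ x ∈ ((I.map ρ).map (QuotientGroup.mk' N)).comap (QuotientGroup.mk' N) at h
    rwa [Subgroup.comap_map_eq, QuotientGroup.ker_mk'] at h
  by_cases hσx : σ x ∈ (I.map σ).rootSet C.primesCompl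
  · obtain ⟨r, hr, w, hw, hwx⟩ := hσx
    -- σ cannot distinguish `x ^ r` from `w`, so a residual quotient `T` that does is paired with
    -- it. A root relation in both coordinates gives `w ^ s = v ^ r` by injectivity on `I`, and
    -- unique roots in `T` then give `τ x ^ r = τ w`, a contradiction.
    have hne : x ^ r * w⁻¹ ≠ 1 := fun h => hx (hI.mem_of_pow_mem hr (mul_inv_eq_one.1 h ▸ hw))
    obtain ⟨T, _, τ, hT, -, hτ⟩ := hX _ (mt Subgroup.mem_bot.1 hne)
    have hnil : Group.IsNilpotent T := hT.1.1
    refine ⟨(σ.prod τ).range, inferInstance, (σ.prod τ).rangeRestrict,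
      (hZ.1.prod hT.1).of_injective (σ.prod τ).range.subtype Subtype.val_injective,
      MonoidHom.rangeRestrict_surjective _, ?_⟩
    rintro ⟨s, hs, v, hv, hvx⟩
    have hvx' : (σ v, τ v) = (σ x ^ s, τ x ^ s) := congrArg Subtype.val hvx
    obtain ⟨h1, h2⟩ := Prod.mk.inj hvx'
    have e : w ^ s = v ^ r := by
      refine hσI (pow_mem hw s) (pow_mem hv r) ?_
      rw [map_pow, map_pow, hwx, h1, ← pow_mul, ← pow_mul, mul_comm]
    have e2 : τ x ^ r = τ w := by
      refine hT.2.pow_left_injective hs ?_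
      rw [← map_pow τ w, e, map_pow, h2, ← pow_mul, ← pow_mul, mul_comm]
    refine hτ ?_
    rw [map_mul, map_pow, map_inv, e2, mul_inv_cancel]
    exact one_mem _
  · exact ⟨Z, _, σ, hZ.1, hσ, hσx⟩

end GroupClass

/-! ### The isolator as the set of roots -/

section Isolators

variable {Q : Set ℕ} {G : Type u} [Group G]

theorem Subgroup.subset_rootSet (Y : Subgroup G) : (Y : Set G) ⊆ Y.rootSet Q :=
  fun y hy => ⟨1, .one, by rwa [pow_one]⟩

theorem Subgroup.mem_rootSet_subgroupOf_closure {Y : Subgroup G}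
    [Group.IsNilpotent (closure (Y.rootSet Q))] (x : closure (Y.rootSet Q)) :
    x ∈ (Y.subgroupOf (closure (Y.rootSet Q))).rootSet Q := by
  refine mem_rootSet_of_closure_rootSet_eq_top ?_ x
  have h : (Y.subgroupOf (closure (Y.rootSet Q))).rootSet Q =
      ((↑) : closure (Y.rootSet Q) → G) ⁻¹' Y.rootSet Q := rfl
  rw [h]
  exact closure_closure_coe_preimage

/-- Nilpotency makes the closure consist of roots, and a root of a root is a root, so the closure is
isolated; any isolated subgroup above `Y` contains all the roots. -/
theorem Subgroup.isolator_eq_closure_rootSet {Y : Subgroup G}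
    [Group.IsNilpotent (closure (Y.rootSet Q))] (hQ : ∀ q ∈ Q, q.Prime) :
    Y.isolator Q = closure (Y.rootSet Q) := by
  refine le_antisymm (sInf_le ⟨fun x q hq hx => ?_, ?_⟩) ?_
  · obtain ⟨r, hr, h⟩ := mem_rootSet_subgroupOf_closure ⟨x ^ q, hx⟩
    refine subset_closure ⟨q * r, (IsPrimeSetNumber.of_prime (hQ q hq) hq).mul hr, ?_⟩
    rw [pow_mul]
    exact h
  · exact fun y hy => subset_closure (Y.subset_rootSet hy)
  · refine le_sInf fun W hW => (closure_le W).2 ?_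
    rintro x ⟨q, hq, hx⟩
    exact hW.1.mem_of_pow_mem hq (hW.2 hx)

/-- The class comparison is made with upper central series inside the closure. It is stated with
lower central series because these map well under homomorphisms. -/
theorem Subgroup.lowerCentralSeries_closure_rootSet_eq_bot [Group.IsNilpotent G]
    (hG : HasNoPrimeSetTorsion Q G) {Y : Subgroup G} {n : ℕ}
    (hY : Y.lowerCentralSeries n = ⊥) : (closure (Y.rootSet Q)).lowerCentralSeries n = ⊥ := by
  set S := closure (Y.rootSet Q) with hS
  have hYS : Y ≤ S := fun y hy => subset_closure (Y.subset_rootSet hy)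
  have h1 : (Y.subgroupOf S).lowerCentralSeries n = ⊥ := by
    rw [← map_subtype_inj, map_bot, map_lowerCentralSeries, map_subgroupOf_eq_of_le hYS, hY]
  have h2 : (⊤ : Subgroup (Y.subgroupOf S)).lowerCentralSeries n = ⊥ := by
    rw [← map_subtype_inj, map_bot, top_subtype_lowerCentralSeries, h1]
  have h3 : Subgroup.upperCentralSeries S n = ⊤ :=
    (hG.of_injective S.subtype S.subtype_injective).upperCentralSeries_eq_top
      mem_rootSet_subgroupOf_closure
      (lowerCentralSeries_eq_bot_iff_upperCentralSeries_eq_top.1 h2)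
  rw [← top_subtype_lowerCentralSeries,
    lowerCentralSeries_eq_bot_iff_upperCentralSeries_eq_top.2 h3, map_bot]

end Isolators

/-! ### Passage to residually bounded groups -/

namespace GroupClass

variable {C : GroupClass.{u}} {X : Type u} [Group X]

theorem IsResidually.hasNoPrimeSetTorsion (hX : C.boundedNilpotentTorsionFree.IsResidually X) :
    HasNoPrimeSetTorsion C.primesCompl X := by
  intro x q hq hxq
  by_contra hx
  obtain ⟨T, _, τ, hT, -, hτ⟩ := hX x hx
  have h : τ x ^ q ∈ (⊥ : Subgroup T) := by
    rw [← map_pow, Subgroup.mem_bot.1 hxq, map_one]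
    exact one_mem _
  refine hτ ?_
  rw [Subgroup.mem_bot.1 (hT.2 _ q hq h)]
  exact one_mem _

/-- A non-trivial element of the term would survive in some residual quotient. Roots map to roots,
so its image would lie in a term already known to vanish there; `X` itself need not be nilpotent. -/
theorem IsResidually.lowerCentralSeries_closure_rootSet_eq_bot
    (hX : C.boundedNilpotentTorsionFree.IsResidually X) {Y : Subgroup X} {n : ℕ}
    (hY : Y.lowerCentralSeries n = ⊥) :
    (Subgroup.closure (Y.rootSet C.primesCompl)).lowerCentralSeries n = ⊥ := by
  refine eq_bot_iff.2 fun g hg => ?_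
  by_contra hg1
  obtain ⟨T, _, τ, hT, -, hτ⟩ := hX g hg1
  have hnil : Group.IsNilpotent T := hT.1.1
  have h1 : (Y.map τ).lowerCentralSeries n = ⊥ := by
    rw [← Subgroup.map_lowerCentralSeries, hY, Subgroup.map_bot]
  have hle : (Subgroup.closure (Y.rootSet C.primesCompl)).map τ ≤
      Subgroup.closure ((Y.map τ).rootSet C.primesCompl) := by
    rw [MonoidHom.map_closure]
    refine Subgroup.closure_mono ?_
    rintro _ ⟨x, ⟨q, hq, hx⟩, rfl⟩
    exact ⟨q, hq, x ^ q, hx, map_pow τ x q⟩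
  have h2 := Subgroup.mem_map_of_mem τ hg
  rw [Subgroup.map_lowerCentralSeries] at h2
  have h3 : τ g ∈
      (Subgroup.closure ((Y.map τ).rootSet C.primesCompl)).lowerCentralSeries n :=
    Subgroup.lowerCentralSeries_mono n hle h2
  rw [Subgroup.lowerCentralSeries_closure_rootSet_eq_bot hT.2 h1] at h3
  exact hτ (by rw [Subgroup.mem_bot.1 h3]; exact one_mem _)

end GroupClass

theorem theorem2p4 (C : GroupClass.{u}) (hC : C.IsRoot) (hper : C.IsPeriodic)
    (X : Type u) [Group X] (hX : C.boundedNilpotentTorsionFree.IsResidually X)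
    (Y : Subgroup X)
    (Z : Type u) [Group Z] (hZ : C.boundedNilpotentTorsionFree Z)
    (σ : X →* Z) (hσ : Function.Surjective σ) (hσY : Set.InjOn σ (Y : Set X)) :
    C.nilpotentPart.IsSeparable (Y.isolator C.primesCompl) ∧
    ((Y.isolator C.primesCompl : Subgroup X) : Set X) = Y.rootSet C.primesCompl ∧
    Group.IsNilpotent Y ∧
    Group.IsNilpotent (Y.isolator C.primesCompl) ∧
    Group.nilpotencyClass (Y.isolator C.primesCompl) = Group.nilpotencyClass Y ∧
    C.nilpotentPart.IsResidually X ∧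
    HasNoPrimeSetTorsion C.primesCompl X ∧
    Set.InjOn σ ((Y.isolator C.primesCompl : Subgroup X) : Set X) ∧
    C.boundedNilpotentTorsionFree (Y.isolator C.primesCompl) := by
  have htf := GroupClass.IsResidually.hasNoPrimeSetTorsion hX
  have hYnil : Group.IsNilpotent Y :=
    (hZ.1.of_injective (σ.comp Y.subtype) fun a b h => Subtype.ext (hσY a.2 b.2 h)).1
  have hlcs := GroupClass.IsResidually.lowerCentralSeries_closure_rootSet_eq_bot hX
    (Subgroup.lowerCentralSeries_eq_bot_of_nilpotencyClass_le (le_refl (Group.nilpotencyClass Y)))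
  have hnil := Subgroup.isNilpotent_of_lowerCentralSeries_eq_bot hlcs
  have hI : Y.isolator C.primesCompl = Subgroup.closure (Y.rootSet C.primesCompl) :=
    Subgroup.isolator_eq_closure_rootSet fun q hq => hq.1
  rw [← hI] at hlcs hnil
  have hYI : Y ≤ Y.isolator C.primesCompl := le_sInf fun W hW => hW.2
  have hiso : (Y.isolator C.primesCompl).IsIsolated C.primesCompl := fun x q hq hx =>
    Subgroup.mem_sInf.2 fun W hW => hW.1 x q hq (Subgroup.mem_sInf.1 hx W hW)
  have hroot : ((Y.isolator C.primesCompl : Subgroup X) : Set X) = Y.rootSet C.primesCompl := by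
    refine Set.Subset.antisymm (fun x hx => ?_) fun x hx => ?_
    · rw [hI] at hnil hx
      obtain ⟨q, hq, h⟩ := Subgroup.mem_rootSet_subgroupOf_closure ⟨x, hx⟩
      exact ⟨q, hq, h⟩
    · obtain ⟨q, hq, h⟩ := hx
      exact hiso.mem_of_pow_mem hq (hYI h)
  have hclass : Group.nilpotencyClass (Y.isolator C.primesCompl) = Group.nilpotencyClass Y := by
    refine le_antisymm ?_ ?_
    · rw [← Subgroup.lowerCentralSeries_eq_bot_iff_nilpotencyClass_le, ← Subgroup.map_subtype_inj,
        Subgroup.map_bot, Subgroup.top_subtype_lowerCentralSeries, hlcs]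
    · rw [← Subgroup.lowerCentralSeries_eq_bot_iff_nilpotencyClass_le, ← Subgroup.map_subtype_inj,
        Subgroup.map_bot, Subgroup.top_subtype_lowerCentralSeries, eq_bot_iff,
        ← Subgroup.lowerCentralSeries_eq_bot_of_nilpotencyClass_le
          (le_refl (Group.nilpotencyClass (Y.isolator C.primesCompl)))]
      exact Subgroup.lowerCentralSeries_mono _ hYI
  have hσI : Set.InjOn σ ((Y.isolator C.primesCompl : Subgroup X) : Set X) := by
    intro x hx y hy hxy
    have hmem : x * y⁻¹ ∈ ((Y.isolator C.primesCompl : Subgroup X) : Set X) :=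
      mul_mem hx (inv_mem hy)
    rw [hroot] at hmem
    obtain ⟨q, hq, h⟩ := hmem
    refine mul_inv_eq_one.1 (htf.eq_one_of_pow_eq_one hq (hσY h (one_mem Y) ?_))
    rw [map_pow, map_mul, map_inv, hxy, mul_inv_cancel, one_pow, map_one]
  refine ⟨GroupClass.isSeparable_nilpotentPart_of_isIsolated hC hper hX hiso hZ σ hσ hσI, hroot,
    hYnil, hnil, hclass,
    -- Absence of torsion says that the trivial subgroup is isolated, so the separation result
    -- applies to it as well.
    GroupClass.isSeparable_nilpotentPart_of_isIsolated hC hper hX htf hZ σ hσ ?_, htf, hσI,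
    hZ.of_injective (σ.comp (Subgroup.subtype _)) fun a b h => Subtype.ext (hσI a.2 b.2 h)⟩
  intro x hx y hy _
  rw [Subgroup.mem_bot.1 hx, Subgroup.mem_bot.1 hy]
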